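/- Let $G$ be a countable group and $\mu$ a probability measure on $G$ whose support generates $G$ as a semigroup, and put $\check\mu(g)=\mu(g^{-1})$. For a probability measure $\kappa$ on $G$, a $(G,\kappa)$-space is a probability space $(X,\nu)$ with an action of $G$ by measurable maps that preserve the measure class of $\nu$, such that $$\int_G\int_X \phi(g^{-1}x)\,d\nu(x)\,d\kappa(g)=\int_X\phi\,d\nu\qquad\text{for all }\phi\in L^\infty(X,\nu).$$ An action of $G$ that preserves the measure class of $\nu$ is ergodic if every measurable set $A$ with $\nu(g^{-1}A\,\triangle\,A)=0$ for all $g\in G$ is $\nu$-null or $\nu$-conull. Let $\mathcal H^\infty_l(G,\mu)$ be the space of bounded functions $f:G\to\mathbb C$ with $f(g)=\int_G f(sg)\,d\mu(s)$ for all $g\in G$, with the supremum norm. The Poisson boundary of $(G,\mu)$ is the $(G,\mu)$-space $(B,m)$ (unique up to isomorphism of measure algebras with $G$-action) for which $$P\phi(g)=\int_B\phi(g^{-1}b)\,dm(b),\qquad g\in G,$$ defines an isometric isomorphism $P$ of $L^\infty(B,m)$ onto $\mathcal H^\infty_l(G,\mu)$. Theorem. Let $(B,m)$ be the Poisson boundary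 of $(G,\mu)$ and let $(X,\nu)$ be a $(G,\check\mu)$-space whose $G$-action is ergodic. Then the diagonal action $g(b,x)=(gb,gx)$ of $G$ on $(B\times X,\,m\otimes\nu)$ preserves the measure class of $m\otimes\nu$ and is ergodic. -/

import Mathlib

open MeasureTheory
open scoped ENNReal

noncomputable section

namespace RandomWalk

/-- A non-singular action: every `g : G` acts by a measurable map which preserves null sets.
Applied to `g` and `g⁻¹`, this says that `G` acts by bi-measurable maps which preserve the
measure class of `ν`. -/
def IsNonsingularAction (G : Type*) [Group G] {X : Type*} [MulAction G X] [MeasurableSpace X]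
    (ν : Measure X) : Prop :=
  ∀ g : G, Measure.QuasiMeasurePreserving (fun x : X => g • x) ν ν

/-- A non-singular action is ergodic if every measurable set that is invariant up to null sets
is null or co-null. -/
structure IsErgodicAction (G : Type*) [Group G] {X : Type*} [MulAction G X] [MeasurableSpace X]
    (ν : Measure X) : Prop where
  nonsingular : IsNonsingularAction G ν
  null_or_conull : ∀ A : Set X, MeasurableSet A →
    (∀ g : G, (fun x : X => g • x) ⁻¹' A =ᵐ[ν] A) → ν A = 0 ∨ ν Aᶜ = 0

/-- `(X, ν)` is a `(G, μ)`-space: a probability space with a non-singular `G`-action such that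
`∫_G ∫_X φ(g⁻¹x) dν(x) dμ(g) = ∫_X φ dν` for all `φ ∈ L^∞(X, ν)`. -/
structure IsStationarySpace {G : Type*} [Group G] [MeasurableSpace G] (μ : Measure G)
    {X : Type*} [MulAction G X] [MeasurableSpace X] (ν : Measure X) : Prop where
  isProbabilityMeasure : IsProbabilityMeasure ν
  nonsingular : IsNonsingularAction G ν
  stationary : ∀ φ : X → ℂ, MemLp φ ∞ ν →
    ∫ g, ∫ x, φ (g⁻¹ • x) ∂ν ∂μ = ∫ x, φ x ∂ν

/-- Bounded functions on a countable discrete group are integrable for a finite measure. -/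
theorem integrable_translate {G : Type*} [Group G] [Countable G] [MeasurableSpace G]
    [DiscreteMeasurableSpace G] (μ : Measure G) [IsFiniteMeasure μ]
    (f : lp (fun _ : G => ℂ) ∞) (g : G) : Integrable (fun s => f (s * g)) μ :=
  Integrable.of_bound (Measurable.of_discrete.aestronglyMeasurable) ‖f‖
    (Filter.Eventually.of_forall fun s => lp.norm_apply_le_norm ENNReal.top_ne_zero f (s * g))

/-- The space `H_l^∞(G, μ)` of bounded left `μ`-harmonic functions on `G`, that is, of bounded
`f : G → ℂ` with `f(g) = ∫_G f(sg) dμ(s)` for all `g`, with the supremum norm. -/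
def boundedHarmonic {G : Type*} [Group G] [Countable G] [MeasurableSpace G]
    [DiscreteMeasurableSpace G] (μ : Measure G) [IsFiniteMeasure μ] :
    Submodule ℂ (lp (fun _ : G => ℂ) ∞) where
  carrier := {f | ∀ g : G, ∫ s, f (s * g) ∂μ = f g}
  zero_mem' := by
    intro g
    simp
  add_mem' := by
    intro f₁ f₂ h₁ h₂ g
    have h := integral_add (integrable_translate μ f₁ g) (integrable_translate μ f₂ g)
    rw [h₁ g, h₂ g] at h
    simpa using h
  smul_mem' := by
    intro c f hf g
    have h := integral_const_mul (μ := μ) c (fun s => f (s * g))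
    rw [hf g] at h
    simpa using h

/-- The Poisson transform `Pφ(g) = ∫_B φ(g⁻¹b) dm(b)`. -/
def poissonTransform {G : Type*} [Group G] {B : Type*} [MulAction G B] [MeasurableSpace B]
    (m : Measure B) (φ : B → ℂ) (g : G) : ℂ :=
  ∫ b, φ (g⁻¹ • b) ∂m

/-- `(B, m)` is (a model of) the Poisson boundary of `(G, μ)`: it is a `(G, μ)`-space for which
the Poisson transform is an isometric isomorphism of `L^∞(B, m)` onto `H_l^∞(G, μ)`. (This
determines `(B, m)` up to isomorphism of measure algebras with `G`-action, and it forces the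
action to be ergodic.) -/
structure IsPoissonBoundary {G : Type*} [Group G] [Countable G] [MeasurableSpace G]
    [DiscreteMeasurableSpace G] (μ : Measure G) [IsFiniteMeasure μ]
    {B : Type*} [MulAction G B] [MeasurableSpace B] (m : Measure B) : Prop where
  isStationarySpace : IsStationarySpace μ m
  exists_isometry : ∃ P : Lp ℂ ∞ m ≃ₗᵢ[ℂ] boundedHarmonic μ,
    ∀ (φ : Lp ℂ ∞ m) (g : G), (P φ : lp (fun _ : G => ℂ) ∞) g = poissonTransform m φ g

end RandomWalk

end

/-! For an almost invariant `A`, let `f x` be the `m`-measure of the section `A_x`. Almost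
everywhere `A_{gx} = g A_x`, so stationarity of `m` makes `f` `μ`-harmonic along orbits.
Stationarity of `ν` under the reflected measure says that `f` and `f ^ 2` keep their mean along a
`μ`-random step, so the mean square of the increment `f (g • x) - f x` vanishes
(`IsStationarySpace.ae_comp_smul_ae_eq`). Hence `f` is invariant, and constant by ergodicity of `X`.
Almost every section then has translates of equal measure, so its indicator has a constant Poisson
transform; injectivity of the transform makes the section null or co-null
(`IsPoissonBoundary.null_or_conull`). -/

namespace RandomWalk

variable {G : Type*} [Group G]

section Action

variable {X : Type*} [MeasurableSpace X] [MulAction G X] {ν : Measure X}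

/-- The diagonal action on a product of non-singular actions is non-singular. -/
theorem IsNonsingularAction.prod {B : Type*} [MeasurableSpace B] [MulAction G B] {m : Measure B}
    [SFinite m] [SFinite ν] (hm : IsNonsingularAction G m) (hν : IsNonsingularAction G ν) :
    IsNonsingularAction G (m.prod ν) := fun g =>
  QuasiMeasurePreserving.prodMap (hm g) (hν g)

/-- For a non-singular action, the elements fixing a function up to null sets form a
semigroup. -/
theorem IsNonsingularAction.comp_smul_ae_eq_of_closure {Y : Type*}
    (h : IsNonsingularAction G ν) (f : X → Y) {S : Set G} (hS : Subsemigroup.closure S = ⊤)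
    (hf : ∀ g ∈ S, (fun x => f (g • x)) =ᵐ[ν] f) (g : G) :
    (fun x => f (g • x)) =ᵐ[ν] f := by
  have hg : g ∈ Subsemigroup.closure S := hS ▸ Subsemigroup.mem_top g
  induction hg using Subsemigroup.closure_induction with
  | mem g hg => exact hf g hg
  | mul a b _ _ ha hb =>
    filter_upwards [(h b).ae ha, hb] with x hax hbx
    rw [mul_smul, hax, hbx]

/-- An integrable invariant function on an ergodic probability space is constant. -/
theorem IsErgodicAction.ae_eq_integral [IsProbabilityMeasure ν] (h : IsErgodicAction G ν)
    {f : X → ℝ} (hf : Measurable f) (hint : Integrable f ν)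
    (hinv : ∀ g : G, (fun x => f (g • x)) =ᵐ[ν] f) : ∀ᵐ x ∂ν, f x = ∫ y, f y ∂ν := by
  have key (S : Set ℝ) (hS : MeasurableSet S) : (∀ᵐ x ∂ν, f x ∉ S) ∨ ∀ᵐ x ∂ν, f x ∈ S := by
    have hS' (g : G) : (fun x => g • x) ⁻¹' (f ⁻¹' S) =ᵐ[ν] f ⁻¹' S := by
      filter_upwards [hinv g] with x hx
      exact congrArg (· ∈ S) hx
    exact (h.null_or_conull (f ⁻¹' S) (hf hS) hS').imp measure_eq_zero_iff_ae_notMem.1 id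
  have hzero : ∫ x, (f x - ∫ y, f y ∂ν) ∂ν = 0 := by
    rw [integral_sub hint (integrable_const _)]
    simp
  have hi : Integrable (fun x => f x - ∫ y, f y ∂ν) ν := hint.sub (integrable_const _)
  -- By ergodicity `f` lies almost surely on one side of its mean; a deviation of constant sign with
  -- zero integral vanishes.
  rcases key (Set.Ici (∫ y, f y ∂ν)) measurableSet_Ici with h1 | h1
  · have h2 : 0 ≤ᵐ[ν] fun x => -(f x - ∫ y, f y ∂ν) := by
      filter_upwards [h1] with x hx
      simp only [Set.mem_Ici, not_le] at hx
      simp only [Pi.zero_apply]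
      linarith
    have h3 := (integral_eq_zero_iff_of_nonneg_ae h2 hi.neg).1
      (by rw [integral_neg, hzero, neg_zero])
    filter_upwards [h3] with x hx
    simp only [Pi.zero_apply] at hx
    linarith
  · have h2 : 0 ≤ᵐ[ν] fun x => f x - ∫ y, f y ∂ν := by
      filter_upwards [h1] with x hx
      simpa using hx
    filter_upwards [(integral_eq_zero_iff_of_nonneg_ae h2 hi).1 hzero] with x hx
    exact sub_eq_zero.1 hx

end Action

/-- The integral of a complex-valued indicator function. -/
theorem integral_indicator_one_complex {B : Type*} [MeasurableSpace B] {m : Measure B}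
    {A : Set B} (hA : MeasurableSet A) :
    ∫ b, A.indicator (1 : B → ℂ) b ∂m = ((m.real A : ℝ) : ℂ) := by
  rw [integral_indicator hA]
  simp

variable [MeasurableSpace G]

/-- Stationarity on measurable sets. -/
theorem IsStationarySpace.integral_measureReal_preimage {μ : Measure G} {B : Type*}
    [MeasurableSpace B] [MulAction G B] {m : Measure B} (h : IsStationarySpace μ m) {A : Set B}
    (hA : MeasurableSet A) :
    ∫ g, m.real ((fun b => g⁻¹ • b) ⁻¹' A) ∂μ = m.real A := by
  have := h.isProbabilityMeasure
  have h1 := h.stationary (A.indicator 1)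
    (memLp_indicator_const ∞ hA 1 (Or.inr (measure_ne_top _ _)))
  have h2 (g : G) : ∫ b, A.indicator (1 : B → ℂ) (g⁻¹ • b) ∂m =
      ((m.real ((fun b => g⁻¹ • b) ⁻¹' A) : ℝ) : ℂ) := by
    have := integral_indicator_one_complex (m := m) ((h.nonsingular g⁻¹).measurable hA)
    exact this
  simp only [h2] at h1
  rw [integral_complex_ofReal, integral_indicator_one_complex hA] at h1
  exact_mod_cast h1

variable [DiscreteMeasurableSpace G]

/-- Stationarity for the reflected measure, on bounded real functions. -/
theorem IsStationarySpace.integral_integral_smul {μ : Measure G} {X : Type*}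
    [MeasurableSpace X] [MulAction G X] {ν : Measure X} (h : IsStationarySpace μ.inv ν)
    {f : X → ℝ} (hf : MemLp f ∞ ν) :
    ∫ g, ∫ x, f (g • x) ∂ν ∂μ = ∫ x, f x ∂ν := by
  have h1 := h.stationary (fun x => (f x : ℂ)) hf.ofReal
  rw [Measure.inv, integral_map Measurable.of_discrete.aemeasurable
    Measurable.of_discrete.aestronglyMeasurable] at h1
  simp only [inv_inv, integral_complex_ofReal] at h1
  exact_mod_cast h1

variable [Countable G]

/-- A bounded function on a `(G, μ̌)`-space which is harmonic for `μ` is invariant under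
`μ`-almost every group element. -/
theorem IsStationarySpace.ae_comp_smul_ae_eq {μ : Measure G} [IsProbabilityMeasure μ] {X : Type*}
    [MeasurableSpace X] [MulAction G X] {ν : Measure X} (h : IsStationarySpace μ.inv ν)
    {f : X → ℝ} (hf : Measurable f) {C : ℝ} (hC : ∀ x, ‖f x‖ ≤ C)
    (hharm : ∀ᵐ x ∂ν, ∫ g, f (g • x) ∂μ = f x) :
    ∀ᵐ g ∂μ, (fun x => f (g • x)) =ᵐ[ν] f := by
  have := h.isProbabilityMeasure
  have hact : Measurable fun p : G × X => p.1 • p.2 :=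
    measurable_from_prod_countable_right fun g => (h.nonsingular g).measurable
  have bdd {Z : Type _} [MeasurableSpace Z] (ρ : Measure Z) [IsFiniteMeasure ρ] {u v : Z → X}
      (hu : Measurable u) (hv : Measurable v) : Integrable (fun z => f (u z) * f (v z)) ρ :=
    Integrable.of_bound ((hf.comp hu).mul (hf.comp hv)).aestronglyMeasurable (C * C)
      (.of_forall fun z => by
        rw [norm_mul]
        exact mul_le_mul (hC _) (hC _) (norm_nonneg _) ((norm_nonneg _).trans (hC (u z))))
  have I1 := bdd (μ.prod ν) hact hact
  have I2 := bdd (μ.prod ν) hact measurable_snd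
  have I3 := bdd (μ.prod ν) measurable_snd measurable_snd
  -- Stationarity of `ν` is used here, for `f ^ 2`; harmonicity enters only in the cross term `E2`.
  have E1 : ∫ p : G × X, f (p.1 • p.2) * f (p.1 • p.2) ∂μ.prod ν = ∫ x, f x * f x ∂ν := by
    rw [integral_prod _ I1]
    refine h.integral_integral_smul (f := fun x => f x * f x) ?_
    refine MemLp.of_bound (hf.mul hf).aestronglyMeasurable (C * C) (.of_forall fun x => ?_)
    rw [norm_mul]
    exact mul_le_mul (hC _) (hC _) (norm_nonneg _) ((norm_nonneg _).trans (hC x))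
  have E2 : ∫ p : G × X, f (p.1 • p.2) * f p.2 ∂μ.prod ν = ∫ x, f x * f x ∂ν := by
    rw [integral_prod_symm _ I2]
    refine integral_congr_ae ?_
    filter_upwards [hharm] with x hx
    rw [integral_mul_const, hx]
  have E3 : ∫ p : G × X, f p.2 * f p.2 ∂μ.prod ν = ∫ x, f x * f x ∂ν := by
    rw [integral_prod _ I3]
    simp
  have E : ∫ p : G × X, (f (p.1 • p.2) - f p.2) ^ 2 ∂μ.prod ν = 0 := by
    have : ∀ p : G × X, (f (p.1 • p.2) - f p.2) ^ 2 =
        f (p.1 • p.2) * f (p.1 • p.2) - f (p.1 • p.2) * f p.2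
          - (f (p.1 • p.2) * f p.2 - f p.2 * f p.2) := fun p => by ring
    simp only [this]
    rw [integral_sub (by exact I1.sub I2) (by exact I2.sub I3), integral_sub I1 I2, integral_sub I2 I3, E1, E2, E3]
    simp
  have I : Integrable (fun p : G × X => (f (p.1 • p.2) - f p.2) ^ 2) (μ.prod ν) := by
    refine ((I1.sub I2).sub (I2.sub I3)).congr (.of_forall fun p => ?_)
    simp only [Pi.sub_apply]
    ring
  have h0 := (integral_eq_zero_iff_of_nonneg (fun p => sq_nonneg _) I).1 E
  filter_upwards [Measure.ae_ae_of_ae_prod h0] with g hg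
  filter_upwards [hg] with x hx
  exact sub_eq_zero.1 (pow_eq_zero_iff two_ne_zero |>.1 hx)

/-- A set in the Poisson boundary all of whose translates have the same measure is null or
co-null. -/
theorem IsPoissonBoundary.null_or_conull {μ : Measure G} [IsFiniteMeasure μ] {B : Type*}
    [MeasurableSpace B] [MulAction G B] {m : Measure B} (h : IsPoissonBoundary μ m) {A : Set B}
    (hA : MeasurableSet A) {c : ℝ} (hc : ∀ g : G, m.real ((fun b => g⁻¹ • b) ⁻¹' A) = c) :
    m A = 0 ∨ m Aᶜ = 0 := by
  have := h.isStationarySpace.isProbabilityMeasure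
  have hns := h.isStationarySpace.nonsingular
  obtain ⟨P, hP⟩ := h.exists_isometry
  have h1 : MemLp (A.indicator (1 : B → ℂ)) ∞ m :=
    memLp_indicator_const ∞ hA 1 (Or.inr (measure_ne_top _ _))
  have h2 : MemLp (fun _ : B => (c : ℂ)) ∞ m := memLp_const _
  have hP' {φ : B → ℂ} (hφ : MemLp φ ∞ m) (g : G) :
      (P (hφ.toLp φ) : lp (fun _ : G => ℂ) ∞) g = ∫ b, φ (g⁻¹ • b) ∂m := by
    rw [hP]
    exact integral_congr_ae ((hns g⁻¹).ae hφ.coeFn_toLp)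
  have hPeq : P (h1.toLp _) = P (h2.toLp _) := by
    refine Subtype.ext (lp.ext (funext fun g => ?_))
    rw [hP', hP']
    have h3 : ∫ b, A.indicator (1 : B → ℂ) (g⁻¹ • b) ∂m =
        ((m.real ((fun b => g⁻¹ • b) ⁻¹' A) : ℝ) : ℂ) :=
      integral_indicator_one_complex (m := m) ((hns g⁻¹).measurable hA)
    rw [h3, hc g]
    simp
  have hae := (MemLp.toLp_eq_toLp_iff h1 h2).1 (P.injective hPeq)
  -- The indicator of `A` is almost everywhere the constant `c`, so `A` is null unless `c = 1`.
  by_cases hc1 : (c : ℂ) = 1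
  · right
    rw [measure_eq_zero_iff_ae_notMem]
    filter_upwards [hae] with b hb hbA
    rw [Set.indicator_of_notMem hbA, hc1] at hb
    exact zero_ne_one hb
  · left
    rw [measure_eq_zero_iff_ae_notMem]
    filter_upwards [hae] with b hb hbA
    rw [Set.indicator_of_mem hbA] at hb
    exact hc1 hb.symm

end RandomWalk

theorem mainTheorem3 {G : Type*} [Group G] [Countable G] [MeasurableSpace G]
    [DiscreteMeasurableSpace G] (μ : Measure G) [IsProbabilityMeasure μ]
    (hμ : Subsemigroup.closure {g : G | μ {g} ≠ 0} = ⊤)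
    {B : Type*} [MeasurableSpace B] [MulAction G B] (m : Measure B)
    (hB : RandomWalk.IsPoissonBoundary μ m)
    {X : Type*} [MeasurableSpace X] [MulAction G X] (ν : Measure X)
    (hX : RandomWalk.IsStationarySpace μ.inv ν)
    (hXerg : RandomWalk.IsErgodicAction G ν) :
    RandomWalk.IsErgodicAction G (m.prod ν) := by
  have hBst := hB.isStationarySpace
  have := hBst.isProbabilityMeasure
  have := hX.isProbabilityMeasure
  refine ⟨hBst.nonsingular.prod hX.nonsingular, fun A hA hinv => ?_⟩
  set f : X → ℝ := fun x => m.real ((fun b => (b, x)) ⁻¹' A) with hf_def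
  have hsec (x : X) : MeasurableSet ((fun b : B => (b, x)) ⁻¹' A) := measurable_prodMk_right hA
  have hf : Measurable f := (measurable_measure_prodMk_right hA).ennreal_toReal
  have hbound (x : X) : ‖f x‖ ≤ 1 := by
    rw [Real.norm_of_nonneg measureReal_nonneg]
    exact measureReal_le_one
  -- The section of `A` over `g • x` is the `g`-translate of the section over `x`.
  have hequiv : ∀ᵐ x ∂ν, ∀ g : G,
      m.real ((fun b => g⁻¹ • b) ⁻¹' ((fun b => (b, x)) ⁻¹' A)) = f (g • x) := by
    refine ae_all_iff.2 fun g => ?_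
    -- The swap puts `x` outermost, so that Fubini gives a statement about almost every section.
    filter_upwards [Measure.ae_ae_of_ae_prod
      ((Measure.measurePreserving_swap (μ := ν) (ν := m)).quasiMeasurePreserving.ae (hinv g))]
      with x hx
    refine measureReal_congr ?_
    filter_upwards [(hBst.nonsingular g⁻¹).ae hx] with b hb
    have hb' : ((g • g⁻¹ • b, g • x) ∈ A) = ((g⁻¹ • b, x) ∈ A) := hb
    rw [smul_inv_smul] at hb'
    exact hb'.symm
  have hharm : ∀ᵐ x ∂ν, ∫ g, f (g • x) ∂μ = f x := by
    filter_upwards [hequiv] with x hx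
    refine Eq.trans ?_ (hBst.integral_measureReal_preimage (hsec x))
    simp only [hx]
  have hsupp := hX.ae_comp_smul_ae_eq hf hbound hharm
  have hfinv := hX.nonsingular.comp_smul_ae_eq_of_closure f hμ fun g hg => by
    -- A property true `μ`-almost everywhere holds at every atom of `μ`.
    by_contra hcon
    exact hg (measure_mono_null (Set.singleton_subset_iff.2 hcon) hsupp)
  have hconst := hXerg.ae_eq_integral hf
    (Integrable.of_bound hf.aestronglyMeasurable 1 (.of_forall hbound)) hfinv
  set c := ∫ x, f x ∂ν
  have hdich : ∀ᵐ x ∂ν, f x = 0 ∨ f x = 1 := by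
    -- Countability of `G` and non-singularity give `f = c` along the whole orbit of almost every
    -- `x`.
    have hall := ae_all_iff.2 fun g : G => (hX.nonsingular g).ae hconst
    filter_upwards [hequiv, hall] with x hx hc
    rcases hB.null_or_conull (hsec x) (fun g => (hx g).trans (hc g)) with h0 | h0
    · exact .inl (by simp [hf_def, measureReal_def, h0])
    · exact .inr (by
        rw [prob_compl_eq_zero_iff (hsec x)] at h0
        simp [hf_def, measureReal_def, h0])
  by_cases hc : c = 0
  · left
    rw [Measure.prod_apply_symm hA, lintegral_eq_zero_iff (measurable_measure_prodMk_right hA)]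
    filter_upwards [hconst] with x hx
    exact (measureReal_eq_zero_iff).1 (hx.trans hc)
  · right
    rw [Measure.prod_apply_symm hA.compl,
      lintegral_eq_zero_iff (measurable_measure_prodMk_right hA.compl)]
    filter_upwards [hconst, hdich] with x hx hx'
    have h1 : m.real ((fun b => (b, x)) ⁻¹' A) = 1 :=
      hx'.resolve_left fun h0 => hc (hx.symm.trans h0)
    rw [Set.preimage_compl]
    refine (prob_compl_eq_zero_iff (hsec x)).2 ?_
    rw [← ENNReal.toReal_eq_one_iff]
    exact h1
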